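/- Let $k\ge 0$ and $n$ be integers with $n\ge\max\{4,\,3k+4\ell-2\}$, where $\ell = n \bmod 3\in\{0,1,2\}$. Let $K_n^k$ be a graph obtained from the complete graph $K_n$ on $n$ vertices by deleting $k$ independent (that is, pairwise vertex-disjoint) edges, and let $S(K_n^k)$ be its subdivision graph, obtained by replacing every edge $uv$ by a new vertex $w$ and the two edges $uw$, $wv$. For a finite connected graph $G$, let $\dim(G)$ (the metric dimension) be the smallest cardinality of a set $T\subseteq V(G)$ such that for any two distinct vertices $x,y$ of $G$ there is $v\in T$ with $d_G(x,v)\ne d_G(y,v)$, and let $\mathrm{edim}(G)$ (the edge metric dimension) be the smallest cardinality of a set $T\subseteq V(G)$ such that for any two distinct edges $e,f$ of $G$ there is $v\in T$ with $d_G(e,v)\ne d_G(f,v)$, where $d_G(xy,v)=\min\{d_G(x,v),d_G(y,v)\}$ for an edge $xy$. Then $$\mathrm{edim}(S(K_n^k))=\left\lceil\frac{2n-2}{3}\right\rceil\quad\text{and}\quad \dim(S(K_n^k))=\left\lceil\frac{2n}{3}\right\rceil .$$ -/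

import Mathlib

namespace SimpleGraph

variable {V : Type*}

/-- The subdivision graph `S(G)`: every edge `e = uv` of `G` is replaced by a new vertex `inr e`
which is adjacent to exactly the two endpoints `inl u` and `inl v` of `e`. -/
def subdivisionGraph (G : SimpleGraph V) : SimpleGraph (V ⊕ G.edgeSet) where
  Adj a b :=
    match a, b with
    | Sum.inl v, Sum.inr e => v ∈ (e : Sym2 V)
    | Sum.inr e, Sum.inl v => v ∈ (e : Sym2 V)
    | _, _ => False
  symm := ⟨by rintro (a | a) (b | b) h <;> exact h⟩
  loopless := ⟨by rintro (a | a) h <;> exact h⟩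

/-- The distance `min (d(x, v)) (d(y, v))` between an edge `e = xy` and a vertex `v`. -/
noncomputable def edgeDist (G : SimpleGraph V) (e : Sym2 V) (v : V) : ℕ :=
  Sym2.lift ⟨fun x y => min (G.dist x v) (G.dist y v), fun _ _ => min_comm _ _⟩ e

/-- `S` is a metric generator: any two distinct vertices of `G` are distinguished by their
distances to some vertex of `S`. -/
def IsMetricGenerator (G : SimpleGraph V) (S : Finset V) : Prop :=
  ∀ x y : V, x ≠ y → ∃ v ∈ S, G.dist x v ≠ G.dist y v

/-- `S` is an edge metric generator: any two distinct edges of `G` are distinguished by their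
distances to some vertex of `S`. -/
def IsEdgeMetricGenerator (G : SimpleGraph V) (S : Finset V) : Prop :=
  ∀ e ∈ G.edgeSet, ∀ f ∈ G.edgeSet, e ≠ f → ∃ v ∈ S, G.edgeDist e v ≠ G.edgeDist f v

/-- The metric dimension `dim(G)` of a finite connected graph: the least cardinality of a
metric generator. -/
noncomputable def metricDim (G : SimpleGraph V) : ℕ :=
  sInf {m : ℕ | ∃ S : Finset V, G.IsMetricGenerator S ∧ S.card = m}

/-- The edge metric dimension `edim(G)` of a finite connected graph: the least cardinality of an
edge metric generator. -/
noncomputable def edgeMetricDim (G : SimpleGraph V) : ℕ :=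
  sInf {m : ℕ | ∃ S : Finset V, G.IsEdgeMetricGenerator S ∧ S.card = m}

end SimpleGraph

open Finset

/-! ### Distances in the subdivision of a nearly complete graph. -/

namespace SimpleGraph

variable {V : Type*}

/-! View a landmark of `S(G)` as a set of one or two vertices of `G` (`baseVertices`). Distances to
landmarks essentially record incidence with these sets. Edge metric generators are exactly the
families separating `V`; metric generators must also tell apart the edges of `G`.

Lower bounds: a separating family leaves at most one vertex `x₀` uncovered, and a member has at most
one leaf (a vertex in no other member). Discharging gives `2 * #X ≤ 3 * #S` for covered vertices `X`
(`two_mul_le_of_separating`), which settles `edim`, and `dim` if all of `V` is covered. If `x₀`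
exists, a path component `a b c` of the family makes the edges `x₀b` and `ac` indistinguishable, so
one of them was deleted. Hence there are at most `k` such paths, and a finer discharging
(`three_mul_le_of_separating`) excludes smaller sets in the stated range.

Upper bounds: split `V` into `⌊n/3⌋` paths and `n % 3` leftover vertices. Take all path edges and
the leftover vertices, omitting one of these (if any) for `edim`. -/

theorem dist_eq_of_potential {G : SimpleGraph V} {t : V} (D : V → ℕ) (h0 : D t = 0)
    (h1 : ∀ x y, G.Adj x y → D x ≤ D y + 1)
    (h2 : ∀ x, x ≠ t → ∃ y, G.Adj x y ∧ D y < D x) (x : V) :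
    G.Reachable x t ∧ G.dist x t = D x := by
  have walk : ∀ n x, D x ≤ n → ∃ p : G.Walk x t, p.length ≤ D x := by
    intro n
    induction n with
    | zero =>
      intro x hx
      by_cases hxt : x = t
      · subst hxt; exact ⟨.nil, by simp⟩
      · obtain ⟨y, -, hy⟩ := h2 x hxt
        omega
    | succ n ih =>
      intro x hx
      by_cases hxt : x = t
      · subst hxt; exact ⟨.nil, by simp⟩
      · obtain ⟨y, hxy, hy⟩ := h2 x hxt
        obtain ⟨p, hp⟩ := ih y (by omega)
        exact ⟨.cons hxy p, by simp; omega⟩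
  have lower : ∀ {x y : V} (p : G.Walk x y), D x ≤ D y + p.length := by
    intro x y p
    induction p with
    | nil => simp
    | cons h p ih =>
      have := h1 _ _ h
      simp only [Walk.length_cons]
      omega
  obtain ⟨p, hp⟩ := walk _ x le_rfl
  refine ⟨⟨p⟩, le_antisymm ((dist_le p).trans hp) ?_⟩
  obtain ⟨q, hq⟩ := Reachable.exists_walk_length_eq_dist ⟨p⟩
  have := lower q
  omega

variable {G : SimpleGraph V}

@[simp] theorem subdivisionGraph_adj_inl_inr {v : V} {e : G.edgeSet} :
    G.subdivisionGraph.Adj (.inl v) (.inr e) ↔ v ∈ (e : Sym2 V) := Iff.rfl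

@[simp] theorem subdivisionGraph_adj_inr_inl {v : V} {e : G.edgeSet} :
    G.subdivisionGraph.Adj (.inr e) (.inl v) ↔ v ∈ (e : Sym2 V) := Iff.rfl

@[simp] theorem subdivisionGraph_not_adj_inl_inl {u v : V} :
    ¬ G.subdivisionGraph.Adj (.inl u) (.inl v) := id

/-- Every vertex has at most one non-neighbour. -/
def IsNearlyComplete (G : SimpleGraph V) : Prop :=
  ∀ x y z, Gᶜ.Adj x y → Gᶜ.Adj x z → y = z

theorem IsNearlyComplete.exists_adj_mem (hG : G.IsNearlyComplete) {v : V} {g : Sym2 V}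
    (hg : g ∈ G.edgeSet) (hv : v ∉ g) : ∃ z ∈ g, G.Adj v z := by
  induction g with
  | _ a b =>
    have hab : a ≠ b := G.ne_of_adj hg
    simp only [Sym2.mem_iff, not_or] at hv
    by_contra! h
    exact hab (hG v a b ⟨hv.1, h a (by simp)⟩ ⟨hv.2, h b (by simp)⟩)

open Classical in
/-- The distance to the subdivision vertex `g` in a subdivided nearly complete graph. -/
noncomputable def subdivisionPotential (g : G.edgeSet) : V ⊕ G.edgeSet → ℕ
  | .inl v => if v ∈ (g : Sym2 V) then 1 else 3
  | .inr f => if f = g then 0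
      else if ∃ v, v ∈ (f : Sym2 V) ∧ v ∈ (g : Sym2 V) then 2 else 4

theorem IsNearlyComplete.dist_subdivision (hG : G.IsNearlyComplete) (g : G.edgeSet)
    (x : V ⊕ G.edgeSet) :
    G.subdivisionGraph.Reachable x (.inr g) ∧
      G.subdivisionGraph.dist x (.inr g) = subdivisionPotential g x := by
  classical
  apply dist_eq_of_potential
  · simp [subdivisionPotential]
  · rintro (v | f) (w | h) hadj
    · exact hadj.elim
    · rw [subdivisionGraph_adj_inl_inr] at hadj
      simp only [subdivisionPotential]
      by_cases hv : v ∈ (g : Sym2 V)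
      · simp [hv]
      · have hne : h ≠ g := by rintro rfl; exact hv hadj
        simp only [hv, hne, if_false]
        split_ifs <;> omega
    · rw [subdivisionGraph_adj_inr_inl] at hadj
      simp only [subdivisionPotential]
      by_cases hw : w ∈ (g : Sym2 V)
      · have : ∃ v, v ∈ (f : Sym2 V) ∧ v ∈ (g : Sym2 V) := ⟨w, hadj, hw⟩
        simp only [hw, this, if_true]
        split_ifs <;> omega
      · simp only [hw, if_false]
        split_ifs <;> omega
    · exact hadj.elim
  · rintro (v | f) hx
    · by_cases hv : v ∈ (g : Sym2 V)
      · exact ⟨.inr g, hv, by simp [subdivisionPotential, hv]⟩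
      · obtain ⟨z, hz, hvz⟩ := hG.exists_adj_mem g.2 hv
        refine ⟨.inr ⟨s(v, z), hvz⟩, by simp, ?_⟩
        have : ∃ u, u ∈ s(v, z) ∧ u ∈ (g : Sym2 V) := ⟨z, by simp, hz⟩
        simp only [subdivisionPotential, hv, this, if_true, if_false]
        split_ifs <;> omega
    · have hne : f ≠ g := fun h => hx (h ▸ rfl)
      by_cases hs : ∃ v, v ∈ (f : Sym2 V) ∧ v ∈ (g : Sym2 V)
      · obtain ⟨v, hvf, hvg⟩ := hs
        refine ⟨.inl v, hvf, ?_⟩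
        have : ∃ v, v ∈ (f : Sym2 V) ∧ v ∈ (g : Sym2 V) := ⟨v, hvf, hvg⟩
        simp [subdivisionPotential, hvg, hne, this]
      · obtain ⟨v, hv⟩ : ∃ v, v ∈ (f : Sym2 V) := ⟨_, Sym2.out_fst_mem _⟩
        refine ⟨.inl v, hv, ?_⟩
        simp only [subdivisionPotential, hne, hs, if_false]
        split_ifs <;> omega

open Classical in
theorem IsNearlyComplete.dist_inl_inr (hG : G.IsNearlyComplete) (v : V) (g : G.edgeSet) :
    G.subdivisionGraph.dist (.inl v) (.inr g) = if v ∈ (g : Sym2 V) then 1 else 3 :=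
  (hG.dist_subdivision g (.inl v)).2

open Classical in
theorem IsNearlyComplete.dist_inr_inl (hG : G.IsNearlyComplete) (v : V) (g : G.edgeSet) :
    G.subdivisionGraph.dist (.inr g) (.inl v) = if v ∈ (g : Sym2 V) then 1 else 3 := by
  rw [dist_comm, hG.dist_inl_inr]

open Classical in
theorem IsNearlyComplete.dist_inr_inr (hG : G.IsNearlyComplete) (f g : G.edgeSet) :
    G.subdivisionGraph.dist (.inr f) (.inr g) = if f = g then 0
      else if ∃ v, v ∈ (f : Sym2 V) ∧ v ∈ (g : Sym2 V) then 2 else 4 :=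
  (hG.dist_subdivision g (.inr f)).2

/-- The exact value depends on whether `u` and `v` are adjacent, but only this bound is needed. The
edge `g` serves to show reachability. -/
theorem IsNearlyComplete.two_le_dist_inl_inl (hG : G.IsNearlyComplete) (g : G.edgeSet) {u v : V}
    (h : u ≠ v) : 2 ≤ G.subdivisionGraph.dist (.inl u) (.inl v) := by
  have hr : G.subdivisionGraph.Reachable (.inl u) (.inl v) :=
    (hG.dist_subdivision g _).1.trans (hG.dist_subdivision g _).1.symm
  have h0 := hr.pos_dist_of_ne (by simpa using h)
  have h1 : G.subdivisionGraph.dist (.inl u) (.inl v) ≠ 1 := by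
    rw [Ne, dist_eq_one_iff_adj]; simp
  omega

/-! ### Landmarks as small sets of vertices, and necessity of separation. -/

/-- The vertices of `G` that a vertex of the subdivision graph stands for. -/
def baseVertices : V ⊕ G.edgeSet → Set V
  | .inl u => {u}
  | .inr e => {v | v ∈ (e : Sym2 V)}

@[simp] theorem mem_baseVertices_inl {u v : V} : v ∈ baseVertices (G := G) (.inl u) ↔ v = u := Iff.rfl

@[simp] theorem mem_baseVertices_inr {v : V} {e : G.edgeSet} :
    v ∈ baseVertices (.inr e) ↔ v ∈ (e : Sym2 V) := Iff.rfl

/-- Any two vertices of `G` are told apart by the base vertices of some element of `S`. -/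
def IsSeparating (S : Finset (V ⊕ G.edgeSet)) : Prop :=
  ∀ x y : V, x ≠ y → ∃ t ∈ S, ¬ (x ∈ baseVertices t ↔ y ∈ baseVertices t)

/-- A landmark other than `e` and `f` sees of an edge only whether the edge meets its base vertices.
-/
theorem dist_inr_eq_of_baseVertices (hG : G.IsNearlyComplete) {e f : G.edgeSet} {t : V ⊕ G.edgeSet}
    (he : t ≠ .inr e) (hf : t ≠ .inr f)
    (h : (∃ v ∈ (e : Sym2 V), v ∈ baseVertices t) ↔ ∃ v ∈ (f : Sym2 V), v ∈ baseVertices t) :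
    G.subdivisionGraph.dist (.inr e) t = G.subdivisionGraph.dist (.inr f) t := by
  classical
  obtain u | g := t
  · simp only [mem_baseVertices_inl, exists_eq_right] at h
    simp only [hG.dist_inr_inl, h]
  · simp only [mem_baseVertices_inr] at h
    have he' : e ≠ g := fun h => he (h ▸ rfl)
    have hf' : f ≠ g := fun h => hf (h ▸ rfl)
    simp only [hG.dist_inr_inr, he', hf', if_false, h]

theorem dist_inr_eq_of_mem_iff (hG : G.IsNearlyComplete) {x y z : V} (hxz : G.Adj z x) (hyz : G.Adj z y)
    (hxy : x ≠ y) {t : V ⊕ G.edgeSet} (h : x ∈ baseVertices t ↔ y ∈ baseVertices t) :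
    G.subdivisionGraph.dist (.inr ⟨s(z, x), hxz⟩) t =
      G.subdivisionGraph.dist (.inr ⟨s(z, y), hyz⟩) t := by
  apply dist_inr_eq_of_baseVertices hG
  · rintro rfl
    simp [hxy.symm, hyz.ne'] at h
  · rintro rfl
    simp [hxy, hxz.ne'] at h
  · simp [or_and_right, exists_or, h]

/-- For a common neighbour `z`, a landmark that does not separate `x` from `y` cannot distinguish
the edges `zx` and `zy`. -/
theorem IsMetricGenerator.isSeparating (hG : G.IsNearlyComplete)
    (hcn : ∀ x y, ∃ z, G.Adj z x ∧ G.Adj z y) {S : Finset (V ⊕ G.edgeSet)}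
    (hS : G.subdivisionGraph.IsMetricGenerator S) : IsSeparating S := by
  intro x y hxy
  obtain ⟨z, hx, hy⟩ := hcn x y
  obtain ⟨t, ht, hne⟩ := hS (.inr ⟨s(z, x), hx⟩) (.inr ⟨s(z, y), hy⟩) (by simp [Subtype.ext_iff, hxy, hx.ne'])
  exact ⟨t, ht, fun h => hne (dist_inr_eq_of_mem_iff hG hx hy hxy h)⟩

theorem IsEdgeMetricGenerator.isSeparating (hG : G.IsNearlyComplete)
    (hcn : ∀ x y, ∃ z, G.Adj z x ∧ G.Adj z y) {S : Finset (V ⊕ G.edgeSet)}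
    (hS : G.subdivisionGraph.IsEdgeMetricGenerator S) : IsSeparating S := by
  intro x y hxy
  obtain ⟨z, hx, hy⟩ := hcn x y
  obtain ⟨t, ht, hne⟩ := hS s(.inl z, .inr ⟨s(z, x), hx⟩) (by simp) s(.inl z, .inr ⟨s(z, y), hy⟩)
    (by simp) (by simp [Subtype.ext_iff, hxy, hx.ne'])
  refine ⟨t, ht, fun h => hne ?_⟩
  change min _ _ = min _ _
  rw [dist_inr_eq_of_mem_iff hG hx hy hxy h]

end SimpleGraph

/-! ### Discharging for separating families of sets of size at most two. -/

section Counting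

variable {V ι : Type*} {S : Finset ι} {F : ι → Set V}

open Classical in
-- Double counting: each member hands out at most `C`, and each vertex collects at least its `lower`
-- value.
theorem sum_le_of_weights [Fintype V] (w : ι → V → ℕ) (lower : V → ℕ) (C : ℕ)
    (hC : ∀ t ∈ S, ∑ x with x ∈ F t, w t x ≤ C)
    (hl : ∀ x, lower x ≤ ∑ t ∈ S with x ∈ F t, w t x) : ∑ x, lower x ≤ C * #S := by
  calc ∑ x, lower x ≤ ∑ x, ∑ t ∈ S with x ∈ F t, w t x := sum_le_sum fun x _ => hl x
    _ = ∑ x, ∑ t ∈ S, if x ∈ F t then w t x else 0 := by simp only [sum_filter]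
    _ = ∑ t ∈ S, ∑ x, if x ∈ F t then w t x else 0 := sum_comm
    _ = ∑ t ∈ S, ∑ x with x ∈ F t, w t x := by simp only [sum_filter]
    _ ≤ ∑ _t ∈ S, C := sum_le_sum hC
    _ = C * #S := by simp [mul_comm]

/-- `t` is the only member of the family `F` on `S` that contains `x`. -/
def IsLeafOf (S : Finset ι) (F : ι → Set V) (t : ι) (x : V) : Prop :=
  t ∈ S ∧ x ∈ F t ∧ ∀ s ∈ S, x ∈ F s → s = t

theorem IsLeafOf.eq {t : ι} {x y : V}
    (hsep : ∀ x y : V, x ≠ y → ∃ t ∈ S, ¬ (x ∈ F t ↔ y ∈ F t))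
    (hx : IsLeafOf S F t x) (hy : IsLeafOf S F t y) : x = y := by
  by_contra hne
  obtain ⟨s, hs, h⟩ := hsep x y hne
  refine h ⟨fun h => ?_, fun h => ?_⟩
  · rw [hx.2.2 s hs h]; exact hy.2.1
  · rw [hy.2.2 s hs h]; exact hx.2.1

/-- `b` is the middle vertex of a path `a b c` whose two edges are members of the family and are
the only members meeting it. -/
def IsPathCentre (S : Finset ι) (F : ι → Set V) (b : V) : Prop :=
  ∃ s t a c, s ≠ t ∧ b ∈ F s ∧ b ∈ F t ∧ (∀ r ∈ S, b ∈ F r → r = s ∨ r = t) ∧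
    IsLeafOf S F s a ∧ IsLeafOf S F t c

theorem isLeafOf_of_filter_eq {t : ι} {x : V} [DecidablePred fun t => x ∈ F t]
    (h : {t ∈ S | x ∈ F t} = {t}) : IsLeafOf S F t x := by
  have ht : t ∈ ({t ∈ S | x ∈ F t} : Finset ι) := by simp [h]
  refine ⟨(mem_filter.1 ht).1, (mem_filter.1 ht).2, fun s hs hx => ?_⟩
  have : s ∈ ({t ∈ S | x ∈ F t} : Finset ι) := mem_filter.2 ⟨hs, hx⟩
  simpa [h] using this

/-- A member gives 2 to its leaf and 1 to any other element, so at most 3. A covered vertex is a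
leaf or lies in two members, so it collects at least 2. -/
theorem two_mul_le_of_separating [Fintype V] (hF : ∀ t, (F t).ncard ≤ 2)
    (hsep : ∀ x y : V, x ≠ y → ∃ t ∈ S, ¬ (x ∈ F t ↔ y ∈ F t)) {X : Finset V}
    (hX : ∀ x ∈ X, ∃ t ∈ S, x ∈ F t) : 2 * #X ≤ 3 * #S := by
  classical
  have key := sum_le_of_weights (S := S) (F := F) (fun t x => if IsLeafOf S F t x then 2 else 1)
    (fun x => if x ∈ X then 2 else 0) 3 ?_ ?_
  · simpa [mul_comm] using key
  · intro t ht
    have hcard : #({x | x ∈ F t} : Finset V) ≤ 2 := by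
      rw [← Set.ncard_coe_finset]; simpa using hF t
    have hleaf : #({x | x ∈ F t ∧ IsLeafOf S F t x} : Finset V) ≤ 1 := by
      rw [card_le_one]
      simp only [mem_filter, mem_univ, true_and]
      exact fun x hx y hy => hx.2.eq hsep hy.2
    have : ∑ x with x ∈ F t, (if IsLeafOf S F t x then 2 else 1) =
        ∑ x with x ∈ F t, (1 + if IsLeafOf S F t x then 1 else 0) := by
      refine sum_congr rfl fun x _ => ?_
      split_ifs <;> rfl
    rw [this, sum_add_distrib, sum_boole]
    simp only [sum_const, smul_eq_mul, mul_one, Nat.cast_id]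
    rw [filter_filter]
    omega
  · intro x
    by_cases hx : x ∈ X
    · simp only [hx, if_true]
      obtain ⟨t, ht, hxt⟩ := hX x hx
      have hpos : 0 < #{t ∈ S | x ∈ F t} := card_pos.2 ⟨t, by simp [ht, hxt]⟩
      obtain h1 | h2 : #{t ∈ S | x ∈ F t} = 1 ∨ 2 ≤ #{t ∈ S | x ∈ F t} := by omega
      · obtain ⟨s, hs⟩ := card_eq_one.1 h1
        rw [hs, sum_singleton, if_pos (isLeafOf_of_filter_eq hs)]
      · calc 2 ≤ ∑ _t ∈ S with x ∈ F _t, 1 := by simpa using h2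
          _ ≤ _ := sum_le_sum fun t _ => by split_ifs <;> omega
    · simp [hx]

open Classical in
-- A member with a leaf gives it 3 and its other element 1; a leafless member gives 2 to each
-- element. Each covered vertex then collects at least 3, except that a vertex in exactly two
-- members, both having a leaf, may collect only 2. These are the path centres.
theorem three_mul_le_of_separating [Fintype V] (hF : ∀ t, (F t).ncard ≤ 2)
    (hsep : ∀ x y : V, x ≠ y → ∃ t ∈ S, ¬ (x ∈ F t ↔ y ∈ F t)) {X : Finset V}
    (hX : ∀ x ∈ X, ∃ t ∈ S, x ∈ F t) :
    3 * #X ≤ 4 * #S + #{b | IsPathCentre S F b} := by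
  set w : ι → V → ℕ := fun t x =>
    if IsLeafOf S F t x then 3 else if ∃ y, IsLeafOf S F t y then 1 else 2 with hw
  have hw1 : ∀ t x, 1 ≤ w t x := by
    intro t x; simp only [hw]; split_ifs <;> omega
  have key := sum_le_of_weights (S := S) (F := F) w
    (fun x => (if x ∈ X then 3 else 0) - if IsPathCentre S F x then 1 else 0) 4 ?_ ?_
  · have h3 : ∑ x, (if x ∈ X then 3 else 0) ≤
        ∑ x, (((if x ∈ X then 3 else 0) - if IsPathCentre S F x then 1 else 0) +
          if IsPathCentre S F x then 1 else 0) := sum_le_sum fun x _ => by omega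
    rw [sum_add_distrib, sum_boole] at h3
    simp at h3
    omega
  · intro t ht
    have hcard : #({x | x ∈ F t} : Finset V) ≤ 2 := by
      rw [← Set.ncard_coe_finset]; simpa using hF t
    by_cases hl : ∃ y, IsLeafOf S F t y
    · obtain ⟨y, hy⟩ := hl
      have hyt : y ∈ ({x | x ∈ F t} : Finset V) := by simpa using hy.2.1
      rw [← add_sum_erase _ _ hyt]
      have h1 : ∑ x ∈ ({x | x ∈ F t} : Finset V).erase y, w t x ≤
          ∑ x ∈ ({x | x ∈ F t} : Finset V).erase y, 1 := by
        refine sum_le_sum fun x hx => ?_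
        have : ¬ IsLeafOf S F t x := fun h => (mem_erase.1 hx).1 (h.eq hsep hy)
        have hex : ∃ y, IsLeafOf S F t y := ⟨y, hy⟩
        simp [hw, this, hex]
      have h2 : w t y = 3 := by simp [hw, hy]
      rw [sum_const, card_erase_of_mem hyt, smul_eq_mul, mul_one] at h1
      omega
    · calc ∑ x with x ∈ F t, w t x = ∑ x with x ∈ F t, 2 := by
            refine sum_congr rfl fun x _ => ?_
            have : ¬ IsLeafOf S F t x := fun h => hl ⟨x, h⟩
            simp [hw, hl, this]
        _ ≤ 4 := by simp; omega
  · intro x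
    by_cases hx : x ∈ X
    swap
    · simp [hx]
    simp only [hx, if_true]
    obtain ⟨t, ht, hxt⟩ := hX x hx
    have hpos : 0 < #{t ∈ S | x ∈ F t} := card_pos.2 ⟨t, by simp [ht, hxt]⟩
    obtain h1 | h2 | h3 : #{t ∈ S | x ∈ F t} = 1 ∨ #{t ∈ S | x ∈ F t} = 2 ∨
      3 ≤ #{t ∈ S | x ∈ F t} := by omega
    · obtain ⟨s, hs⟩ := card_eq_one.1 h1
      rw [hs, sum_singleton]
      simp [hw, isLeafOf_of_filter_eq hs]
    · obtain ⟨s, t, hst, hs⟩ := card_eq_two.1 h2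
      rw [hs, sum_pair hst]
      have hmem : ∀ r, (r ∈ S ∧ x ∈ F r) ↔ r = s ∨ r = t := by
        intro r; simpa using Finset.ext_iff.1 hs r
      by_cases hl : (∃ y, IsLeafOf S F s y) ∧ ∃ y, IsLeafOf S F t y
      · obtain ⟨⟨a, ha⟩, ⟨c, hc⟩⟩ := hl
        have : IsPathCentre S F x := ⟨s, t, a, c, hst, ((hmem s).2 (.inl rfl)).2,
          ((hmem t).2 (.inr rfl)).2, fun r hr hxr => (hmem r).1 ⟨hr, hxr⟩, ha, hc⟩
        have h1 := hw1 s x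
        have h2 := hw1 t x
        simp only [this, if_true]
        omega
      · have h1 := hw1 s x
        have h2 := hw1 t x
        rcases not_and_or.1 hl with h | h
        · have hx : ¬ IsLeafOf S F s x := fun h' => h ⟨x, h'⟩
          have : w s x = 2 := by simp [hw, h, hx]
          omega
        · have hx : ¬ IsLeafOf S F t x := fun h' => h ⟨x, h'⟩
          have : w t x = 2 := by simp [hw, h, hx]
          omega
    · calc _ ≤ 3 := by omega
        _ ≤ ∑ _t ∈ S with x ∈ F _t, 1 := by simpa using h3
        _ ≤ _ := sum_le_sum fun t _ => hw1 t x

end Counting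

/-! ### Lower bounds for both dimensions. -/

namespace SimpleGraph

variable {V : Type*} {G : SimpleGraph V}

theorem eq_or_eq_of_mem_baseVertices {t : V ⊕ G.edgeSet} {x y z : V} (hx : x ∈ baseVertices t)
    (hy : y ∈ baseVertices t) (hz : z ∈ baseVertices t) (hxz : x ≠ z) (hyz : y ≠ z) : x = y := by
  obtain u | ⟨e, he⟩ := t
  · simp only [mem_baseVertices_inl] at hx hy
    rw [hx, hy]
  · induction e with
    | _ p q =>
      simp only [mem_baseVertices_inr, Sym2.mem_iff] at hx hy hz
      grind

theorem ncard_baseVertices_le (t : V ⊕ G.edgeSet) : (baseVertices t).ncard ≤ 2 := by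
  obtain u | ⟨e, he⟩ := t
  · have : baseVertices (G := G) (.inl u) = {u} := rfl
    simp [this]
  · induction e with
    | _ p q =>
      have : baseVertices (.inr ⟨s(p, q), he⟩ : V ⊕ G.edgeSet) = {p, q} := by ext; simp
      rw [this]
      exact (Set.ncard_insert_le _ _).trans (by simp)

theorem IsMetricGenerator.exists_nonadjacent_of_isPathCentre (hG : G.IsNearlyComplete)
    {S : Finset (V ⊕ G.edgeSet)} (hS : G.subdivisionGraph.IsMetricGenerator S) {x₀ : V}
    (hx₀ : ∀ t ∈ S, x₀ ∉ baseVertices t) {b : V} (hb : IsPathCentre S baseVertices b) :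
    ∃ m ∈ Gᶜ.edgeSet, m = s(x₀, b) ∨ ∃ s a c, b ≠ a ∧ b ≠ c ∧ b ∈ baseVertices s ∧
      IsLeafOf S baseVertices s a ∧ (∃ t, b ∈ baseVertices t ∧ IsLeafOf S baseVertices t c) ∧
      m = s(a, c) := by
  obtain ⟨s, t, a, c, hst, hbs, hbt, hb, ha, hc⟩ := hb
  have hba : b ≠ a := by
    rintro rfl; exact hst (ha.2.2 t hc.1 hbt).symm
  have hbc : b ≠ c := by
    rintro rfl; exact hst (hc.2.2 s ha.1 hbs)
  have hac : a ≠ c := by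
    rintro rfl; exact hst (hc.2.2 s ha.1 ha.2.1)
  have hxb : x₀ ≠ b := by
    rintro rfl; exact hx₀ s ha.1 hbs
  by_cases h1 : G.Adj x₀ b
  swap
  · exact ⟨s(x₀, b), ⟨hxb, h1⟩, .inl rfl⟩
  by_cases h2 : G.Adj a c
  swap
  · exact ⟨s(a, c), ⟨hac, h2⟩, .inr ⟨s, a, c, hba, hbc, hbs, ha, ⟨t, hbt, hc⟩, rfl⟩⟩
  -- Neither edge is a landmark, and both meet exactly the landmarks `s` and `t`.
  obtain ⟨r, hr, hne⟩ := hS (.inr ⟨s(a, c), h2⟩) (.inr ⟨s(x₀, b), h1⟩)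
    (by simp [Subtype.ext_iff, hba.symm, hbc.symm])
  refine absurd (dist_inr_eq_of_baseVertices hG ?_ ?_ ?_) hne
  · rintro rfl
    exact hst ((ha.2.2 _ hr (by simp)).symm.trans (hc.2.2 _ hr (by simp)))
  · rintro rfl
    exact hx₀ _ hr (by simp)
  · simp only [Sym2.mem_iff, or_and_right, exists_or, exists_eq_left, hx₀ r hr, false_or]
    constructor
    · rintro (h | h)
      · rwa [ha.2.2 r hr h]
      · rwa [hc.2.2 r hr h]
    · intro h
      rcases hb r hr h with rfl | rfl
      · exact .inl ha.2.1
      · exact .inr hc.2.1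

open Classical in
-- The non-edge assigned to a centre determines it: `x₀` is never a leaf, so the two kinds do not
-- clash; a leaf `a` determines its member, whose only other element is the centre.
theorem IsMetricGenerator.card_isPathCentre_le [Fintype V] (hG : G.IsNearlyComplete)
    {S : Finset (V ⊕ G.edgeSet)} (hS : G.subdivisionGraph.IsMetricGenerator S) {x₀ : V}
    (hx₀ : ∀ t ∈ S, x₀ ∉ baseVertices t) :
    #{b | IsPathCentre S baseVertices b} ≤ Gᶜ.edgeSet.ncard := by
  have : Nonempty (Sym2 V) := ⟨s(x₀, x₀)⟩
  choose! m hm hm' using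
    fun b (hb : IsPathCentre S baseVertices b) =>
      hS.exists_nonadjacent_of_isPathCentre hG hx₀ hb
  rw [← Set.ncard_coe_finset]
  have hne : ∀ {t a}, IsLeafOf S baseVertices t a → x₀ ≠ a := by
    rintro t a ha rfl; exact hx₀ t ha.1 ha.2.1
  refine Set.ncard_le_ncard_of_injOn m (fun b hb => hm b (by simpa using hb)) ?_ (Set.toFinite _)
  intro b hb b' hb' heq
  simp only [coe_filter, mem_univ, true_and, Set.mem_ofPred_eq] at hb hb'
  rcases hm' b hb with h | ⟨s, a, c, hba, hbc, hbs, ha, ⟨t, hbt, hc⟩, h⟩ <;>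
    rcases hm' b' hb' with h' | ⟨s', a', c', hba', hbc', hbs', ha', ⟨t', hbt', hc'⟩, h'⟩ <;>
    rw [h, h'] at heq
  · exact Sym2.congr_right.1 heq
  · simp [hne ha', hne hc'] at heq
  · simp [(hne ha).symm, (hne hc).symm] at heq
  · have haa : a ∈ s(a', c') := heq ▸ Sym2.mem_mk_left a c
    rcases Sym2.mem_iff.1 haa with rfl | rfl
    · have := ha'.2.2 s ha.1 ha.2.1
      subst this
      exact eq_or_eq_of_mem_baseVertices hbs hbs' ha.2.1 hba hba'
    · have := hc'.2.2 s ha.1 ha.2.1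
      subst this
      exact eq_or_eq_of_mem_baseVertices hbs hbt' ha.2.1 hba hbc'

theorem IsEdgeMetricGenerator.two_mul_card_le [Fintype V] (hG : G.IsNearlyComplete)
    (hcn : ∀ x y, ∃ z, G.Adj z x ∧ G.Adj z y) {S : Finset (V ⊕ G.edgeSet)}
    (hS : G.subdivisionGraph.IsEdgeMetricGenerator S) : 2 * Fintype.card V ≤ 3 * #S + 2 := by
  classical
  have hsep := hS.isSeparating hG hcn
  by_cases h : ∃ x₀, ∀ t ∈ S, x₀ ∉ baseVertices t
  · obtain ⟨x₀, hx₀⟩ := h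
    have := two_mul_le_of_separating ncard_baseVertices_le hsep (X := univ.erase x₀) ?_
    · rw [card_erase_of_mem (mem_univ _), card_univ] at this
      omega
    · intro x hx
      obtain ⟨t, ht, h⟩ := hsep x x₀ (mem_erase.1 hx).1
      exact ⟨t, ht, by simpa [hx₀ t ht] using h⟩
  · push Not at h
    have := two_mul_le_of_separating ncard_baseVertices_le hsep (X := univ) fun x _ => h x
    rw [card_univ] at this
    omega

theorem IsMetricGenerator.two_mul_card_le [Fintype V] (hG : G.IsNearlyComplete)
    (hcn : ∀ x y, ∃ z, G.Adj z x ∧ G.Adj z y) {S : Finset (V ⊕ G.edgeSet)}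
    (hS : G.subdivisionGraph.IsMetricGenerator S) :
    2 * Fintype.card V ≤ 3 * #S ∨ 2 * Fintype.card V ≤ 3 * #S + 2 ∧
      3 * Fintype.card V ≤ 4 * #S + Gᶜ.edgeSet.ncard + 3 := by
  classical
  have hsep := hS.isSeparating hG hcn
  by_cases h : ∃ x₀, ∀ t ∈ S, x₀ ∉ baseVertices t
  · obtain ⟨x₀, hx₀⟩ := h
    have hX : ∀ x ∈ univ.erase x₀, ∃ t ∈ S, x ∈ baseVertices t := by
      intro x hx
      obtain ⟨t, ht, h⟩ := hsep x x₀ (mem_erase.1 hx).1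
      exact ⟨t, ht, by simpa [hx₀ t ht] using h⟩
    have h2 := two_mul_le_of_separating ncard_baseVertices_le hsep hX
    have h3 := three_mul_le_of_separating ncard_baseVertices_le hsep hX
    have h4 := hS.card_isPathCentre_le hG hx₀
    rw [card_erase_of_mem (mem_univ _), card_univ] at h2 h3
    right
    constructor <;> omega
  · push Not at h
    have := two_mul_le_of_separating ncard_baseVertices_le hsep (X := univ) fun x _ => h x
    rw [card_univ] at this
    exact .inl this

end SimpleGraph

/-! ### Generators built from a partition into paths. -/

namespace SimpleGraph

variable {V κ : Type*} {G : SimpleGraph V}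

theorem IsNearlyComplete.edgeDist_inl_eq_zero_iff (hG : G.IsNearlyComplete) {u v w : V}
    (h : G.Adj v u) :
    G.subdivisionGraph.edgeDist s(.inl v, .inr ⟨s(v, u), h⟩) (.inl w) = 0 ↔ v = w := by
  change min _ _ = 0 ↔ _
  rw [hG.dist_inr_inl]
  by_cases hvw : v = w
  · simp [hvw]
  · have := hG.two_le_dist_inl_inl ⟨s(v, u), h⟩ hvw
    split_ifs <;> simp only [hvw, iff_false] <;> omega

theorem IsNearlyComplete.edgeDist_inl_eq_one_iff (hG : G.IsNearlyComplete) {u v w : V}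
    (h : G.Adj v u) (hvw : v ≠ w) :
    G.subdivisionGraph.edgeDist s(.inl v, .inr ⟨s(v, u), h⟩) (.inl w) = 1 ↔ u = w := by
  change min _ _ = 1 ↔ _
  dsimp only
  rw [hG.dist_inr_inl]
  have := hG.two_le_dist_inl_inl ⟨s(v, u), h⟩ hvw
  have hmem : w ∈ s(v, u) ↔ u = w := by simp [Ne.symm hvw, eq_comm]
  by_cases hw : u = w
  · rw [if_pos (hmem.2 hw), iff_true_right hw]; omega
  · rw [if_neg (mt hmem.1 hw), iff_false_right hw]; omega

open Classical in
theorem IsNearlyComplete.edgeDist_inr (hG : G.IsNearlyComplete) {u v : V} (h : G.Adj v u)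
    (g : G.edgeSet) :
    G.subdivisionGraph.edgeDist s(.inl v, .inr ⟨s(v, u), h⟩) (.inr g) =
      if v ∈ (g : Sym2 V) then if u ∈ (g : Sym2 V) then 0 else 1
      else if u ∈ (g : Sym2 V) then 2 else 3 := by
  change min _ _ = _
  rw [hG.dist_inr_inr, hG.dist_inl_inr]
  have hg : (⟨s(v, u), h⟩ : G.edgeSet) = g ↔ v ∈ (g : Sym2 V) ∧ u ∈ (g : Sym2 V) := by
    rw [Subtype.ext_iff, eq_comm, ← Sym2.mem_and_mem_iff h.ne]
  by_cases hv : v ∈ (g : Sym2 V) <;> by_cases hu : u ∈ (g : Sym2 V) <;>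
    simp [hg, hv, hu, or_and_right, exists_or]

theorem exists_eq_of_mem_edgeSet_subdivisionGraph {e : Sym2 (V ⊕ G.edgeSet)}
    (he : e ∈ G.subdivisionGraph.edgeSet) :
    ∃ v u, ∃ h : G.Adj v u, e = s(.inl v, .inr ⟨s(v, u), h⟩) := by
  have key : ∀ (v : V) (g : G.edgeSet), v ∈ (g : Sym2 V) →
      ∃ v' u, ∃ h : G.Adj v' u,
        s((.inl v : V ⊕ G.edgeSet), .inr g) = s(.inl v', .inr ⟨s(v', u), h⟩) := by
    rintro v ⟨g, hg⟩ hv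
    obtain ⟨u, rfl⟩ := Sym2.mem_iff_exists.1 hv
    exact ⟨v, u, hg, rfl⟩
  induction e with
  | _ x y =>
    obtain v | f := x <;> obtain w | g := y
    · exact he.elim
    · exact key v g he
    · rw [Sym2.eq_swap]; exact key w f he
    · exact he.elim

/-- Distances to the landmarks determine first the end `v` in `G` (distance 0 to a vertex, at most 1
to an edge), then the other end `u` of the edge of `G` that was subdivided. -/
theorem IsSeparating.isEdgeMetricGenerator (hG : G.IsNearlyComplete)
    {S : Finset (V ⊕ G.edgeSet)} (hS : IsSeparating S) :
    G.subdivisionGraph.IsEdgeMetricGenerator S := by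
  classical
  intro e he f hf hef
  by_contra! hall
  obtain ⟨v, u, h, rfl⟩ := exists_eq_of_mem_edgeSet_subdivisionGraph he
  obtain ⟨v', u', h', rfl⟩ := exists_eq_of_mem_edgeSet_subdivisionGraph hf
  have hvv : v = v' := by
    by_contra hne
    obtain ⟨t, ht, hsep⟩ := hS v v' hne
    have hd := hall t ht
    obtain w | g := t
    · have h1 := hG.edgeDist_inl_eq_zero_iff (w := w) h
      have h2 := hG.edgeDist_inl_eq_zero_iff (w := w) h'
      rw [hd] at h1
      exact hsep (h1.symm.trans h2)
    · rw [hG.edgeDist_inr, hG.edgeDist_inr] at hd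
      simp only [mem_baseVertices_inr] at hsep
      grind
  subst hvv
  have huu : u ≠ u' := by rintro rfl; exact hef rfl
  obtain ⟨t, ht, hsep⟩ := hS u u' huu
  have hd := hall t ht
  obtain w | g := t
  · by_cases hvw : v = w
    · subst hvw
      exact hsep (by simp [h.ne', h'.ne'])
    · have h1 := hG.edgeDist_inl_eq_one_iff h hvw
      have h2 := hG.edgeDist_inl_eq_one_iff h' hvw
      rw [hd] at h1
      exact hsep (h1.symm.trans h2)
  · rw [hG.edgeDist_inr, hG.edgeDist_inr] at hd
    simp only [mem_baseVertices_inr] at hsep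
    grind

/-- The vertices of `G` are partitioned into the paths `a i`, `b i`, `c i` and the set `L`. -/
structure IsPathPartition (G : SimpleGraph V) (a b c : κ → V) (L : Finset V) (p : V → Option κ) :
    Prop where
  adj_ab : ∀ i, G.Adj (a i) (b i)
  adj_bc : ∀ i, G.Adj (b i) (c i)
  ne_ac : ∀ i, a i ≠ c i
  part_a : ∀ i, p (a i) = some i
  part_b : ∀ i, p (b i) = some i
  part_c : ∀ i, p (c i) = some i
  mem_iff : ∀ v, v ∈ L ↔ p v = none
  cover : ∀ v i, p v = some i → v = a i ∨ v = b i ∨ v = c i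

namespace IsPathPartition

variable {a b c : κ → V} {L : Finset V} {p : V → Option κ}

/-- The dangerous pair is `e = ac` and `f = bw`. Here `w` lies outside the path, so it is either a
landmark in `L` or on another path; in both cases `f` meets a landmark that `e` misses. -/
theorem not_mem_ends_of_forall_meets (h : G.IsPathPartition a b c L p) {e f : Sym2 V}
    (hf : f ∈ G.edgeSet) (hfa : ∀ i, f ≠ s(a i, b i)) (hfc : ∀ i, f ≠ s(b i, c i))
    (hab : ∀ i, (a i ∈ e ∨ b i ∈ e) ↔ (a i ∈ f ∨ b i ∈ f))
    (hbc : ∀ i, (b i ∈ e ∨ c i ∈ e) ↔ (b i ∈ f ∨ c i ∈ f))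
    (hL : ∀ v ∈ L, v ∈ e ↔ v ∈ f) {i : κ} (hb : b i ∈ f) (ha : a i ∈ e) : c i ∉ e := by
  intro hc
  obtain rfl : e = s(a i, c i) := (Sym2.mem_and_mem_iff (h.ne_ac i)).1 ⟨ha, hc⟩
  obtain ⟨w, rfl⟩ := Sym2.mem_iff_exists.1 hb
  have hne : b i ≠ w := G.ne_of_adj hf
  have hwa : w ≠ a i := by rintro rfl; exact hfa i Sym2.eq_swap
  have hwc : w ≠ c i := by rintro rfl; exact hfc i rfl
  simp only [Sym2.mem_iff] at hab hbc hL
  by_cases hw : w ∈ L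
  · have := (hL w hw).2 (.inr rfl)
    tauto
  · obtain ⟨j, hj⟩ := Option.ne_none_iff_exists'.1 (fun hn => hw ((h.mem_iff w).2 hn))
    have h1 := h.part_a i
    have h2 := h.part_c i
    have h3 := h.part_a j
    have h4 := h.part_b j
    have h5 := h.part_c j
    have h6 := hab j
    have h7 := hbc j
    rcases h.cover w j hj with rfl | rfl | rfl <;> grind

theorem mem_of_forall_meets (h : G.IsPathPartition a b c L p) {x y : V} {f : Sym2 V}
    (he : s(x, y) ∈ G.edgeSet) (hf : f ∈ G.edgeSet)
    (hea : ∀ i, s(x, y) ≠ s(a i, b i)) (hec : ∀ i, s(x, y) ≠ s(b i, c i))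
    (hfa : ∀ i, f ≠ s(a i, b i)) (hfc : ∀ i, f ≠ s(b i, c i))
    (hab : ∀ i, (a i ∈ s(x, y) ∨ b i ∈ s(x, y)) ↔ (a i ∈ f ∨ b i ∈ f))
    (hbc : ∀ i, (b i ∈ s(x, y) ∨ c i ∈ s(x, y)) ↔ (b i ∈ f ∨ c i ∈ f))
    (hL : ∀ v ∈ L, v ∈ s(x, y) ↔ v ∈ f) : x ∈ f := by
  by_contra hxf
  have hxe : x ∈ s(x, y) := Sym2.mem_mk_left x y
  by_cases hx : x ∈ L
  · exact hxf ((hL x hx).1 hxe)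
  obtain ⟨i, hi⟩ := Option.ne_none_iff_exists'.1 (fun hn => hx ((h.mem_iff x).2 hn))
  have hab' := hab i
  have hbc' := hbc i
  have hK := h.not_mem_ends_of_forall_meets hf hfa hfc hab hbc hL (i := i)
  have hK' := h.not_mem_ends_of_forall_meets he hea hec (fun i => (hab i).symm)
    (fun i => (hbc i).symm) (fun v hv => (hL v hv).symm) (i := i)
  have h1 : ¬ (a i ∈ s(x, y) ∧ b i ∈ s(x, y)) := fun hm =>
    hea i ((Sym2.mem_and_mem_iff (h.adj_ab i).ne).1 hm)
  have h2 : ¬ (b i ∈ s(x, y) ∧ c i ∈ s(x, y)) := fun hm =>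
    hec i ((Sym2.mem_and_mem_iff (h.adj_bc i).ne).1 hm)
  rcases h.cover x i hi with rfl | rfl | rfl
  · have hb := (hab'.1 (.inl hxe)).resolve_left hxf
    exact (hbc'.2 (.inl hb)).elim (fun hm => h1 ⟨hxe, hm⟩) (hK hb hxe)
  · exact hK' hxe ((hab'.1 (.inr hxe)).resolve_right hxf) ((hbc'.1 (.inl hxe)).resolve_left hxf)
  · have hb := (hbc'.1 (.inr hxe)).resolve_right hxf
    exact (hab'.2 (.inr hb)).elim (fun hm => hK hb hm hxe) (fun hm => h2 ⟨hm, hxe⟩)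

open Classical in
/-- The edges of all paths, together with a set of original vertices. -/
noncomputable def landmarks [Fintype κ] (h : G.IsPathPartition a b c L p) (U : Finset V) :
    Finset (V ⊕ G.edgeSet) :=
  univ.image (fun i => .inr ⟨s(a i, b i), h.adj_ab i⟩) ∪
    univ.image (fun i => .inr ⟨s(b i, c i), h.adj_bc i⟩) ∪ U.image .inl

variable [Fintype κ] (h : G.IsPathPartition a b c L p) (U : Finset V)

theorem card_landmarks_le : #(h.landmarks U) ≤ 2 * Fintype.card κ + #U := by
  classical
  refine (card_union_le _ _).trans (add_le_add ((card_union_le _ _).trans ?_) card_image_le)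
  rw [two_mul]
  exact add_le_add card_image_le card_image_le

theorem ab_mem_landmarks (i : κ) : .inr ⟨s(a i, b i), h.adj_ab i⟩ ∈ h.landmarks U := by
  simp [landmarks]

theorem bc_mem_landmarks (i : κ) : .inr ⟨s(b i, c i), h.adj_bc i⟩ ∈ h.landmarks U := by
  simp [landmarks]

theorem inl_mem_landmarks {u : V} (hu : u ∈ U) : .inl u ∈ h.landmarks U := by
  simp [landmarks, hu]

theorem isSeparating_landmarks
    (hU : ∀ x ∈ L, ∀ y ∈ L, x ∉ U → y ∉ U → x = y) : IsSeparating (h.landmarks U) := by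
  intro x y hxy
  by_contra! hall
  have hab := fun i => hall _ (h.ab_mem_landmarks U i)
  have hbc := fun i => hall _ (h.bc_mem_landmarks U i)
  have hu := fun u hu => hall _ (h.inl_mem_landmarks U (u := u) hu)
  simp only [mem_baseVertices_inr, mem_baseVertices_inl, Sym2.mem_iff] at hab hbc hu
  have key : ∀ x y : V, (∀ i, x = a i ∨ x = b i ↔ y = a i ∨ y = b i) →
      (∀ i, x = b i ∨ x = c i ↔ y = b i ∨ y = c i) → x ∉ L → x = y := by
    intro x y hab hbc hx
    obtain ⟨i, hi⟩ := Option.ne_none_iff_exists'.1 (fun hn => hx ((h.mem_iff x).2 hn))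
    have h1 := hab i
    have h2 := hbc i
    have := (h.adj_ab i).ne
    have := (h.adj_bc i).ne
    have := h.ne_ac i
    rcases h.cover x i hi with rfl | rfl | rfl <;> grind
  by_cases hx : x ∈ L
  · by_cases hy : y ∈ L
    · by_cases hxU : x ∈ U
      · exact hxy ((hu x hxU).1 rfl).symm
      · by_cases hyU : y ∈ U
        · exact hxy ((hu y hyU).2 rfl)
        · exact hxy (hU x hx y hy hxU hyU)
    · exact hxy (key y x (fun i => (hab i).symm) (fun i => (hbc i).symm) hy).symm
  · exact hxy (key x y hab hbc hx)

theorem isMetricGenerator_landmarks [Nonempty κ] (hG : G.IsNearlyComplete) :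
    G.subdivisionGraph.IsMetricGenerator (h.landmarks L) := by
  classical
  have hsep := h.isSeparating_landmarks L fun x hx y hy hxL => (hxL hx).elim
  obtain ⟨i₀⟩ := ‹Nonempty κ›
  rintro (x | e) (y | f) hxy
  · obtain ⟨t, ht, hne⟩ := hsep x y (by simpa using hxy)
    refine ⟨t, ht, fun heq => hne ?_⟩
    obtain w | g := t
    · have hpos := fun x => hG.two_le_dist_inl_inl ⟨s(a i₀, b i₀), h.adj_ab i₀⟩ (u := x) (v := w)
      by_cases hx : x = w <;> by_cases hy : y = w
      · simp [hx, hy]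
      · have := hpos y hy
        rw [hx, dist_self] at heq
        omega
      · have := hpos x hx
        rw [hy, dist_self] at heq
        omega
      · simp [hx, hy]
    · rw [hG.dist_inl_inr, hG.dist_inl_inr] at heq
      simp only [mem_baseVertices_inr]
      grind
  -- Parity: distances to a subdivision vertex are odd from original vertices and even from
  -- subdivision vertices.
  · refine ⟨_, h.ab_mem_landmarks L i₀, ?_⟩
    rw [hG.dist_inl_inr, hG.dist_inr_inr]
    split_ifs <;> simp
  · refine ⟨_, h.ab_mem_landmarks L i₀, ?_⟩
    rw [hG.dist_inl_inr, hG.dist_inr_inr]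
    split_ifs <;> simp
  · have hef : e ≠ f := by simpa using hxy
    by_contra! hall
    have hnotmem : ∀ g ∈ ({e, f} : Set G.edgeSet), .inr g ∉ h.landmarks L := by
      intro g hg hgm
      have := hall _ hgm
      rw [hG.dist_inr_inr, hG.dist_inr_inr] at this
      rcases hg with rfl | rfl
      · simp only [if_true, hef.symm, if_false] at this
        split_ifs at this
      · simp only [if_true, hef, if_false] at this
        split_ifs at this
    have hmeet : ∀ t ∈ h.landmarks L, (∃ v ∈ (e : Sym2 V), v ∈ baseVertices t) ↔
        ∃ v ∈ (f : Sym2 V), v ∈ baseVertices t := by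
      intro t ht
      have hd := hall t ht
      obtain w | g := t
      · rw [hG.dist_inr_inl, hG.dist_inr_inl] at hd
        simp only [mem_baseVertices_inl, exists_eq_right]
        grind
      · have he : e ≠ g := by rintro rfl; exact hnotmem _ (by simp) ht
        have hf : f ≠ g := by rintro rfl; exact hnotmem _ (by simp) ht
        rw [hG.dist_inr_inr, hG.dist_inr_inr, if_neg he, if_neg hf] at hd
        simp only [mem_baseVertices_inr]
        by_cases h1 : ∃ v ∈ (e : Sym2 V), v ∈ (g : Sym2 V) <;>
          by_cases h2 : ∃ v ∈ (f : Sym2 V), v ∈ (g : Sym2 V) <;>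
            simp only [h1, h2, if_true, if_false] at hd ⊢ <;> omega
    have hna : ∀ g ∈ ({e, f} : Set G.edgeSet), ∀ i, (g : Sym2 V) ≠ s(a i, b i) := by
      intro g hg i hgi
      have : g = ⟨s(a i, b i), h.adj_ab i⟩ := Subtype.ext hgi
      exact hnotmem g hg (this ▸ h.ab_mem_landmarks L i)
    have hnc : ∀ g ∈ ({e, f} : Set G.edgeSet), ∀ i, (g : Sym2 V) ≠ s(b i, c i) := by
      intro g hg i hgi
      have : g = ⟨s(b i, c i), h.adj_bc i⟩ := Subtype.ext hgi
      exact hnotmem g hg (this ▸ h.bc_mem_landmarks L i)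
    have hab := fun i => hmeet _ (h.ab_mem_landmarks L i)
    have hbc := fun i => hmeet _ (h.bc_mem_landmarks L i)
    have hu := fun u hu => hmeet _ (h.inl_mem_landmarks L (u := u) hu)
    simp only [mem_baseVertices_inr, mem_baseVertices_inl, Sym2.mem_iff, and_or_left, exists_or,
      exists_eq_right] at hab hbc hu
    have hea := hna e (by simp)
    have hfa := hna f (by simp)
    have hec := hnc e (by simp)
    have hfc := hnc f (by simp)
    obtain ⟨e, he⟩ := e
    obtain ⟨f, hf⟩ := f
    simp only at hab hbc hu hea hfa hec hfc
    apply hef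
    rw [Subtype.mk.injEq]
    induction e with
    | _ x y =>
      have hadj : G.Adj x y := he
      have hx : x ∈ f := h.mem_of_forall_meets he hf hea hec hfa hfc hab hbc hu
      have hy : y ∈ f := by
        rw [Sym2.eq_swap] at he hea hec hab hbc hu
        exact h.mem_of_forall_meets he hf hea hec hfa hfc hab hbc hu
      exact ((Sym2.mem_and_mem_iff (G.ne_of_adj hadj)).1 ⟨hx, hy⟩).symm

end IsPathPartition

/-- Three vertices span at most one non-edge, so every triple carries a path and any grouping into
triples works. -/
theorem IsNearlyComplete.exists_isPathPartition [Fintype V] (hG : G.IsNearlyComplete) {m r : ℕ}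
    (hV : Fintype.card V = 3 * m + r) :
    ∃ (a b c : Fin m → V) (L : Finset V) (p : V → Option (Fin m)),
      G.IsPathPartition a b c L p ∧ #L = r := by
  classical
  have φ : Fin m × Fin 3 ⊕ Fin r ≃ V := Fintype.equivOfCardEq (by simp [hV, mul_comm])
  have htriple : ∀ x y z : V, x ≠ y → x ≠ z → y ≠ z → ∃ a b c, G.Adj a b ∧ G.Adj b c ∧ a ≠ c ∧
      (∀ v, v = x ∨ v = y ∨ v = z ↔ v = a ∨ v = b ∨ v = c) := by
    intro x y z hxy hxz hyz
    by_cases h1 : G.Adj x y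
    · by_cases h2 : G.Adj y z
      · exact ⟨x, y, z, h1, h2, hxz, fun v => Iff.rfl⟩
      · have h3 : G.Adj x z := by
          by_contra h3
          exact hxy (hG z x y ⟨hxz.symm, fun h => h3 h.symm⟩ ⟨hyz.symm, fun h => h2 h.symm⟩)
        exact ⟨y, x, z, h1.symm, h3, hyz, fun v => by tauto⟩
    · have h2 : G.Adj x z := by
        by_contra h2
        exact hyz (hG x y z ⟨hxy, h1⟩ ⟨hxz, h2⟩)
      have h3 : G.Adj y z := by
        by_contra h3
        exact hxz (hG y x z ⟨hxy.symm, fun h => h1 h.symm⟩ ⟨hyz, h3⟩)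
      exact ⟨x, z, y, h2, h3.symm, hxy, fun v => by tauto⟩
  choose a b c hab hbc hac hv using fun i : Fin m =>
    htriple (φ (.inl (i, 0))) (φ (.inl (i, 1))) (φ (.inl (i, 2))) (by simp) (by simp) (by simp)
  set p : V → Option (Fin m) := fun v => (φ.symm v).elim (fun q => some q.1) (fun _ => none) with hp
  have hpart : ∀ v i, (v = a i ∨ v = b i ∨ v = c i) → p v = some i := by
    intro v i h
    rcases (hv i v).2 h with rfl | rfl | rfl <;> simp [hp]
  refine ⟨a, b, c, univ.image (fun j => φ (.inr j)), p, ⟨hab, hbc, hac, ?_, ?_, ?_, ?_, ?_⟩, ?_⟩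
  · exact fun i => hpart _ i (by simp)
  · exact fun i => hpart _ i (by simp)
  · exact fun i => hpart _ i (by simp)
  · intro v
    obtain ⟨q | j, rfl⟩ := φ.surjective v <;> simp [hp]
  · intro v i hi
    rw [← hv]
    obtain ⟨⟨i', j⟩ | j, rfl⟩ := φ.surjective v
    · obtain rfl : i' = i := by simpa [hp] using hi
      fin_cases j <;> simp
    · simp [hp] at hi
  · rw [card_image_of_injective _ fun i j hij => Sum.inr_injective (φ.injective hij)]
    simp

end SimpleGraph

/-! ### Values of the two dimensions. -/

namespace SimpleGraph

variable {V : Type*} {G : SimpleGraph V}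

theorem exists_common_adj [Fintype V] {d : ℕ} (hd : ∀ x, {z | ¬ G.Adj z x}.ncard ≤ d)
    (hV : 2 * d < Fintype.card V) (x y : V) : ∃ z, G.Adj z x ∧ G.Adj z y := by
  by_contra! h
  have huniv : ({z | ¬ G.Adj z x} ∪ {z | ¬ G.Adj z y} : Set V) = Set.univ := by
    ext z
    simpa [imp_iff_not_or] using h z
  have := Set.ncard_union_le {z | ¬ G.Adj z x} {z | ¬ G.Adj z y}
  rw [huniv, Set.ncard_univ, Nat.card_eq_fintype_card] at this
  have := hd x
  have := hd y
  omega

theorem IsNearlyComplete.exists_common_adj [Fintype V] (hG : G.IsNearlyComplete)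
    (hV : 5 ≤ Fintype.card V ∨ G = ⊤ ∧ 3 ≤ Fintype.card V) (x y : V) :
    ∃ z, G.Adj z x ∧ G.Adj z y := by
  rcases hV with hV | ⟨rfl, hV⟩
  · refine SimpleGraph.exists_common_adj (d := 2) (fun x => ?_) (by omega) x y
    obtain ⟨w, hw⟩ : ∃ w, ∀ z, Gᶜ.Adj x z → z = w := by
      by_cases h : ∃ w, Gᶜ.Adj x w
      · obtain ⟨w, hw⟩ := h
        exact ⟨w, fun z hz => hG x z w hz hw⟩
      · exact ⟨x, fun z hz => (h ⟨z, hz⟩).elim⟩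
    have hsub : {z | ¬ G.Adj z x} ⊆ {x, w} := by
      intro z hz
      by_cases hzx : z = x
      · exact .inl hzx
      · exact .inr (hw z ⟨Ne.symm hzx, fun h => hz h.symm⟩)
    exact (Set.ncard_le_ncard hsub).trans ((Set.ncard_insert_le _ _).trans (by simp))
  · refine SimpleGraph.exists_common_adj (d := 1) (fun x => ?_) (by omega) x y
    simp

theorem edgeMetricDim_le {S : Finset V} (hS : G.IsEdgeMetricGenerator S) :
    G.edgeMetricDim ≤ #S := Nat.sInf_le ⟨S, hS, rfl⟩

theorem metricDim_le {S : Finset V} (hS : G.IsMetricGenerator S) :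
    G.metricDim ≤ #S := Nat.sInf_le ⟨S, hS, rfl⟩

theorem IsEdgeMetricGenerator.exists_card_eq {S : Finset V} (hS : G.IsEdgeMetricGenerator S) :
    ∃ T, G.IsEdgeMetricGenerator T ∧ #T = G.edgeMetricDim :=
  Nat.sInf_mem (s := {m | ∃ T, G.IsEdgeMetricGenerator T ∧ #T = m}) ⟨_, S, hS, rfl⟩

theorem IsMetricGenerator.exists_card_eq {S : Finset V} (hS : G.IsMetricGenerator S) :
    ∃ T, G.IsMetricGenerator T ∧ #T = G.metricDim :=
  Nat.sInf_mem (s := {m | ∃ T, G.IsMetricGenerator T ∧ #T = m}) ⟨_, S, hS, rfl⟩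

theorem IsNearlyComplete.edgeMetricDim_subdivisionGraph [Fintype V] (hG : G.IsNearlyComplete)
    (hcn : ∀ x y, ∃ z, G.Adj z x ∧ G.Adj z y) :
    G.subdivisionGraph.edgeMetricDim = 2 * Fintype.card V / 3 := by
  classical
  obtain ⟨a, b, c, L, p, h, hL⟩ := hG.exists_isPathPartition (m := Fintype.card V / 3)
    (r := Fintype.card V % 3) (by omega)
  -- One leftover vertex may stay uncovered; truncation handles `L = ∅`.
  obtain ⟨U, hUL, hU⟩ := exists_subset_card_eq (s := L) (n := #L - 1) (by omega)
  have hgen := (h.isSeparating_landmarks U ?_).isEdgeMetricGenerator hG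
  · have hle := (edgeMetricDim_le hgen).trans (h.card_landmarks_le U)
    obtain ⟨T, hT, hcard⟩ := hgen.exists_card_eq
    have := hT.two_mul_card_le hG hcn
    rw [Fintype.card_fin] at hle
    omega
  · have hone : #(L \ U) ≤ 1 := by
      rw [card_sdiff_of_subset hUL]; omega
    rw [card_le_one] at hone
    intro x hx y hy hxU hyU
    exact hone x (by simp [hx, hxU]) y (by simp [hy, hyU])

theorem IsNearlyComplete.metricDim_subdivisionGraph [Fintype V] (hG : G.IsNearlyComplete)
    (hcn : ∀ x y, ∃ z, G.Adj z x ∧ G.Adj z y) (hV : 3 ≤ Fintype.card V)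
    (hk : 3 * Gᶜ.edgeSet.ncard + 4 * (Fintype.card V % 3) ≤ Fintype.card V + 2) :
    G.subdivisionGraph.metricDim = (2 * Fintype.card V + 2) / 3 := by
  classical
  obtain ⟨a, b, c, L, p, h, hL⟩ := hG.exists_isPathPartition (m := Fintype.card V / 3)
    (r := Fintype.card V % 3) (by omega)
  have : Nonempty (Fin (Fintype.card V / 3)) := ⟨⟨0, by omega⟩⟩
  have hgen := h.isMetricGenerator_landmarks hG
  have hle := (metricDim_le hgen).trans (h.card_landmarks_le L)
  obtain ⟨T, hT, hcard⟩ := hgen.exists_card_eq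
  have := hT.two_mul_card_le hG hcn
  rw [Fintype.card_fin] at hle
  -- Write `n = 3m + r`. For `r = 0` the first bound suffices. Otherwise `#T = 2m + r - 1` would
  -- force `m ≤ k + r - 1`, where `k` counts the non-edges, contradicting `hk`.
  omega

end SimpleGraph

theorem Nat.ceil_div_three (a : ℕ) : ⌈(a : ℚ) / 3⌉₊ = (a + 2) / 3 := by
  refine eq_of_forall_ge_iff fun c => ?_
  rw [Nat.ceil_le, div_le_iff₀ (by norm_num)]
  norm_cast
  omega

open SimpleGraph in
theorem theorem4 {V : Type*} [Fintype V] (n k : ℕ) (hV : Fintype.card V = n)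
    (hn : max 4 (3 * (k : ℤ) + 4 * ((n % 3 : ℕ) : ℤ) - 2) ≤ (n : ℤ))
    (M : (⊤ : SimpleGraph V).Subgraph) (hM : M.IsMatching) (hk : M.edgeSet.ncard = k) :
    ((⊤ : SimpleGraph V).deleteEdges M.edgeSet).subdivisionGraph.edgeMetricDim
        = ⌈(2 * (n : ℚ) - 2) / 3⌉₊ ∧
      ((⊤ : SimpleGraph V).deleteEdges M.edgeSet).subdivisionGraph.metricDim
        = ⌈2 * (n : ℚ) / 3⌉₊ := by
  obtain ⟨hn4, hnk⟩ := max_le_iff.1 hn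
  have hn4' : 4 ≤ n := by exact_mod_cast hn4
  have hnk' : 3 * k + 4 * (n % 3) ≤ n + 2 := by omega
  set G := (⊤ : SimpleGraph V).deleteEdges M.edgeSet with hGdef
  have hcompl : ∀ x y, Gᶜ.Adj x y ↔ M.Adj x y := by
    intro x y
    simp only [compl_adj, hGdef, deleteEdges_adj, top_adj, Subgraph.mem_edgeSet]
    have := fun h : M.Adj x y => h.ne
    tauto
  have hG : G.IsNearlyComplete := fun x y z hy hz =>
    hM.eq_of_adj_left ((hcompl x y).1 hy) ((hcompl x z).1 hz)
  have hedge : Gᶜ.edgeSet = M.edgeSet := by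
    ext e
    induction e with
    | _ x y => exact hcompl x y
  -- If `k > 0` then `n ≥ 5`, since `n = 4` has `n % 3 = 1` and would need `3k + 4 ≤ 6`.
  have hcn := hG.exists_common_adj (by
    rcases Nat.eq_zero_or_pos k with rfl | hkpos
    · right
      rw [Set.ncard_eq_zero] at hk
      exact ⟨by rw [hGdef, hk, deleteEdges_empty], by omega⟩
    · left; omega)
  have h1 := hG.edgeMetricDim_subdivisionGraph hcn
  have h2 := hG.metricDim_subdivisionGraph hcn (by omega) (by rw [hedge, hk, hV]; exact hnk')
  rw [hV] at h1 h2
  have e1 : (2 * (n : ℚ) - 2) = ((2 * n - 2 : ℕ) : ℚ) := by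
    rw [Nat.cast_sub (by omega)]; push_cast; ring
  have e2 : 2 * (n : ℚ) = ((2 * n : ℕ) : ℚ) := by push_cast; ring
  rw [h1, h2, e1, e2, Nat.ceil_div_three, Nat.ceil_div_three]
  constructor <;> omega
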